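/- For a nonnegative integer $n$, let $\mathrm{pod}_{-3}(n)$ denote the number of partition triples of $n$ in which the odd parts of each partition are distinct, that is, the number of ordered triples $(\lambda_1,\lambda_2,\lambda_3)$ of (possibly empty) integer partitions with $|\lambda_1|+|\lambda_2|+|\lambda_3|=n$ such that, for each $i$, no odd number occurs more than once as a part of $\lambda_i$. Equivalently, $\sum_{n\ge 0}\mathrm{pod}_{-3}(n)q^n=\prod_{j\ge 1}\left(\frac{1+q^{2j-1}}{1-q^{2j}}\right)^3$. Then $\mathrm{pod}_{-3}(n)$ is divisible by $9$ for at least $1/72$ of all nonnegative integers $n$, in the sense of lower natural density: \[ \liminf_{N\to\infty}\frac{\#\{0\le n<N:\ 9\mid \mathrm{pod}_{-3}(n)\}}{N}\ \ge\ \frac1{72}. \] -/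

import Mathlib

/-- The partitions of `n` in which the odd parts are distinct (an odd part occurs at most once;
even parts are unrestricted). -/
def podPartitions (n : ℕ) : Finset n.Partition :=
  {p : n.Partition | ∀ i ∈ p.parts, Odd i → p.parts.count i ≤ 1}

/-- The partition `k`-tuples of `n` in which every partition has distinct odd parts: a sequence
of sizes `m 0, …, m (k - 1)` with sum `n`, and for each `i` a partition of `m i` whose odd parts
are distinct. -/
def podTuples (k n : ℕ) : Finset (Σ m : Fin k → ℕ, ∀ i, (m i).Partition) :=
  (Finset.Nat.antidiagonalTuple k n).sigma fun m => Fintype.piFinset fun i => podPartitions (m i)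

/-- `podNeg k n` is the number `pod_{-k}(n)` of partition `k`-tuples of `n` in which, in each
partition, the odd parts are distinct. -/
def podNeg (k n : ℕ) : ℕ := (podTuples k n).card

/-- The lower natural (asymptotic) density of a set `S` of natural numbers: the limit inferior,
as `N → ∞`, of the proportion of elements of `S` among `0, 1, …, N - 1`. -/
noncomputable def lowerDensity (S : Set ℕ) : ℝ :=
  Filter.liminf (fun N : ℕ => ((S ∩ Set.Iio N).ncard : ℝ) / (N : ℝ)) Filter.atTop

/-! Write `ψ(q) = ∑ q^(s(s+1)/2)`. By Gauss' product formula `∑ (-1)^n pod(n) q^n = 1/ψ(q)`, so up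
to sign `podNeg 3 n` is the coefficient `a(n)` of `ψ^(-3)`, and only `a(n)` modulo 9 matters.

Splitting exponents modulo 3 gives `ψ(q) = A(q^3) + q ψ(q^9)`. Multiplying `ψ` over the cube roots
of unity yields `cubic_identity`: `(A^3 + q B^3) B = ψ^4`, with `B = ψ(q^3)`. Modulo 9 also `ψ^9 =
B^3`, so `ψ^(-3) = ψ^6 / B^3`. Repeated trisection then gives `∑ a(9k+6) q^k = B ψ^2` and `∑
a(27k+24) q^k = B^2 ψ`. Since no triangular number is 2 modulo 3, `a(81m+78) = 0`; the residue 1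
returns `B ψ^2`, so `a(81k+51) = a(9k+6)`.

Thus vanishing propagates along `n ↦ 9n - 3`, which multiplies `8n - 3` by 9. The resulting
progressions of modulus `81 * 9^j` are disjoint and have total density `∑ 1/(81 * 9^j) = 1/72`. -/

open PowerSeries

/-! ### Splitting a power series by exponents modulo 3. -/

section Trisection

variable {R S : Type*} [CommRing R] [CommRing S]

/-- The substitution `X ↦ X ^ 3`. -/
noncomputable abbrev expandThree : R⟦X⟧ →ₐ[R] R⟦X⟧ := PowerSeries.expand 3 three_ne_zero

/-- The series `∑ a (3 n + r) X ^ n` extracted from `∑ a n X ^ n`. -/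
noncomputable def trisect (r : ℕ) : R⟦X⟧ →ₗ[R] R⟦X⟧ where
  toFun f := PowerSeries.mk fun n => coeff (3 * n + r) f
  map_add' f g := by ext n; simp
  map_smul' a f := by ext n; simp

@[simp]
lemma coeff_trisect (r n : ℕ) (f : R⟦X⟧) : coeff n (trisect r f) = coeff (3 * n + r) f := by
  simp [trisect]

lemma coeff_X_pow_mul_expandThree {r i : ℕ} (hr : r < 3) (hi : i < 3) (n : ℕ) (h : R⟦X⟧) :
    coeff (3 * n + r) (X ^ i * expandThree h) = if i = r then coeff n h else 0 := by
  rw [coeff_X_pow_mul']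
  split_ifs with h1 h2 h2
  · subst h2
    rw [Nat.add_sub_cancel, mul_comm 3 n, mul_comm n 3, PowerSeries.coeff_expand_mul]
  · exact PowerSeries.coeff_expand_of_not_dvd _ _ _ (by omega)
  · omega
  · rfl

lemma trisect_X_pow_mul_expandThree {r i : ℕ} (hr : r < 3) (hi : i < 3) (h : R⟦X⟧) :
    trisect r (X ^ i * expandThree h) = if i = r then h else 0 := by
  ext n
  rw [coeff_trisect, coeff_X_pow_mul_expandThree hr hi]
  split_ifs <;> simp

lemma eq_sum_trisect (f : R⟦X⟧) :
    f = ∑ i ∈ Finset.range 3, X ^ i * expandThree (trisect i f) := by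
  ext n
  obtain ⟨m, r, hr, rfl⟩ : ∃ m r, r < 3 ∧ n = 3 * m + r :=
    ⟨n / 3, n % 3, Nat.mod_lt _ (by norm_num), by omega⟩
  rw [map_sum, Finset.sum_congr rfl fun i hi =>
    coeff_X_pow_mul_expandThree hr (Finset.mem_range.1 hi) m _]
  simp [hr]

/-- Trisection is linear over series in `X ^ 3`; every later computation divides out such a factor.
-/
lemma trisect_expandThree_mul {r : ℕ} (hr : r < 3) (g f : R⟦X⟧) :
    trisect r (expandThree g * f) = g * trisect r f := by
  conv_lhs => rw [eq_sum_trisect f, Finset.mul_sum, map_sum]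
  rw [Finset.sum_congr rfl (g := fun i => if i = r then g * trisect i f else 0)]
  · simp [hr]
  · intro i hi
    rw [mul_left_comm, ← map_mul, trisect_X_pow_mul_expandThree hr (Finset.mem_range.1 hi)]

lemma expandThree_injective : Function.Injective (expandThree : R⟦X⟧ → R⟦X⟧) := by
  intro f g h
  ext n
  have := congrArg (coeff (3 * n)) h
  simpa only [PowerSeries.coeff_expand_mul] using this

lemma map_trisect (φ : R →+* S) (r : ℕ) (f : R⟦X⟧) :
    PowerSeries.map φ (trisect r f) = trisect r (PowerSeries.map φ f) := by
  ext n; simp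

lemma rescale_expandThree {w : R} (hw : w ^ 3 = 1) (f : R⟦X⟧) :
    rescale w (expandThree f) = expandThree f := by
  ext n
  rw [coeff_rescale]
  by_cases h : 3 ∣ n
  · obtain ⟨m, rfl⟩ := h
    rw [pow_mul, hw, one_pow, one_mul]
  · rw [PowerSeries.coeff_expand_of_not_dvd _ _ _ h, mul_zero]

end Trisection

/-! ### Gauss' product formula for `ψ`, by finite truncations. -/

section Gauss

variable {R S : Type*} [CommRing R] [CommRing S]

/-- The finite product `∏_{k < n} (1 - q ^ (2 k + a))`. -/
def evenStepProd (a : ℕ) (q : S) (n : ℕ) : S := ∏ k ∈ Finset.range n, (1 - q ^ (2 * k + a))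

lemma evenStepProd_succ (a : ℕ) (q : S) (n : ℕ) :
    evenStepProd a q (n + 1) = evenStepProd a q n * (1 - q ^ (2 * n + a)) :=
  Finset.prod_range_succ _ _

@[simp]
lemma evenStepProd_zero (a : ℕ) (q : S) : evenStepProd a q 0 = 1 := rfl

lemma map_evenStepProd (φ : R →+* S) (a : ℕ) (q : R) (n : ℕ) :
    φ (evenStepProd a q n) = evenStepProd a (φ q) n := by
  simp [evenStepProd]

/-- The summand of Shanks' finite form of Gauss' identity, without its power of `q`. -/
def shanksCoeff (q : S) (n s : ℕ) : S :=
  (∏ k ∈ Finset.Ico s n, (1 - q ^ (2 * k + 2))) * evenStepProd 1 q s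

lemma shanksCoeff_succ_left (q : S) {n s : ℕ} (h : s ≤ n) :
    shanksCoeff q (n + 1) s = shanksCoeff q n s * (1 - q ^ (2 * n + 2)) := by
  rw [shanksCoeff, shanksCoeff, Finset.prod_Ico_succ_top h]
  ring

lemma shanksCoeff_succ_right (q : S) {n s : ℕ} (h : s < n) :
    (1 - q ^ (2 * s + 2)) * shanksCoeff q n (s + 1) =
      shanksCoeff q n s * (1 - q ^ (2 * s + 1)) := by
  rw [shanksCoeff, shanksCoeff, Finset.prod_eq_prod_Ico_succ_bot h, evenStepProd_succ]
  ring

lemma shanksCoeff_self (q : S) (n : ℕ) : shanksCoeff q n n = evenStepProd 1 q n := by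
  rw [shanksCoeff, Finset.Ico_self, Finset.prod_empty, one_mul]

lemma shanksCoeff_zero (q : S) (n : ℕ) : shanksCoeff q n 0 = evenStepProd 2 q n := by
  rw [shanksCoeff, evenStepProd_zero, mul_one, evenStepProd, Finset.range_eq_Ico]

/-- The sum telescopes. Only `m = n` is used; a free `m` makes the induction possible. -/
lemma sum_shanksCoeff_sub (q : S) (n m : ℕ) (h : m ≤ n) :
    ∑ s ∈ Finset.range (m + 1), (shanksCoeff q (n + 1) s * q ^ (s * (2 * n + 3)) -
        (1 - q ^ (2 * n + 1)) * (shanksCoeff q n s * q ^ (s * (2 * n + 1)))) =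
      shanksCoeff q n m * (1 - q ^ (2 * m + 1)) * q ^ ((m + 1) * (2 * n + 1)) := by
  induction m with
  | zero =>
    rw [Finset.sum_range_one, shanksCoeff_succ_left q h]
    ring
  | succ m ih =>
    rw [Finset.sum_range_succ, ih (by omega), shanksCoeff_succ_left q h,
      ← shanksCoeff_succ_right q (by omega)]
    ring

/-- Shanks' finite form of Gauss' identity for triangular numbers. -/
theorem shanks_identity (q : S) (n : ℕ) :
    evenStepProd 1 q n * ∑ s ∈ Finset.range (2 * n + 1), q ^ (s * (s + 1) / 2) =
      ∑ s ∈ Finset.range (n + 1), shanksCoeff q n s * q ^ (s * (2 * n + 1)) := by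
  induction n with
  | zero => simp [shanksCoeff]
  | succ n ih =>
    have key := sum_shanksCoeff_sub q n n le_rfl
    rw [Finset.sum_sub_distrib, ← Finset.mul_sum, ← ih, shanksCoeff_self] at key
    rw [Finset.sum_range_succ _ (n + 1), shanksCoeff_self, evenStepProd_succ,
      show 2 * (n + 1) + 1 = 2 * n + 1 + 1 + 1 by ring, Finset.sum_range_succ,
      Finset.sum_range_succ,
      show (2 * n + 1) * (2 * n + 1 + 1) / 2 = (n + 1) * (2 * n + 1) from
        Nat.div_eq_of_eq_mul_left (by norm_num) (by ring),
      show (2 * n + 1 + 1) * (2 * n + 1 + 1 + 1) / 2 = (n + 1) * (2 * n + 3) from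
        Nat.div_eq_of_eq_mul_left (by norm_num) (by ring)]
    linear_combination -key

open Classical in
variable (R) in
/-- Ramanujan's theta function `ψ(q) = ∑_{s ≥ 0} q ^ (s (s + 1) / 2)`. -/
noncomputable def ramanujanPsi : R⟦X⟧ :=
  PowerSeries.mk fun n => if ∃ s, s * (s + 1) = 2 * n then 1 else 0

open Classical in
lemma coeff_ramanujanPsi (n : ℕ) :
    coeff n (ramanujanPsi R) = if ∃ s, s * (s + 1) = 2 * n then 1 else 0 := by
  rw [ramanujanPsi, coeff_mk]

lemma map_ramanujanPsi (φ : R →+* S) : PowerSeries.map φ (ramanujanPsi R) = ramanujanPsi S := by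
  ext n
  simp [coeff_ramanujanPsi, apply_ite φ]

lemma X_pow_dvd_ramanujanPsi_sub (n : ℕ) :
    (X : R⟦X⟧) ^ (n + 1) ∣
      ramanujanPsi R - ∑ s ∈ Finset.range (n + 1), X ^ (s * (s + 1) / 2) := by
  classical
  rw [X_pow_dvd_iff]
  intro m hm
  have h2 (s : ℕ) : m = s * (s + 1) / 2 ↔ s * (s + 1) = 2 * m := by
    have := Nat.two_dvd_mul_add_one s
    omega
  rw [map_sub, sub_eq_zero, coeff_ramanujanPsi, map_sum]
  simp only [coeff_X_pow, h2]
  split_ifs with h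
  · obtain ⟨s, hs⟩ := h
    rw [Finset.sum_eq_single s]
    · rw [if_pos hs]
    · intro t _ hts
      rw [if_neg]
      intro ht
      rcases lt_or_gt_of_ne hts with h | h <;> nlinarith
    · intro h
      rw [Finset.mem_range] at h
      nlinarith
  · rw [Finset.sum_eq_zero]
    intro s _
    rw [if_neg fun hs => h ⟨s, hs⟩]

/-- Gauss' identity `ψ(q) = ∏ (1 - q ^ (2 k + 2)) / (1 - q ^ (2 k + 1))` in truncated form. -/
theorem X_pow_dvd_evenStepProd_mul_ramanujanPsi_sub (n : ℕ) :
    (X : R⟦X⟧) ^ (2 * n + 1) ∣ evenStepProd 1 X n * ramanujanPsi R - evenStepProd 2 X n := by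
  have h1 := (X_pow_dvd_ramanujanPsi_sub (R := R) (2 * n)).mul_left (evenStepProd 1 X n)
  rw [mul_sub, shanks_identity, Finset.sum_range_succ', shanksCoeff_zero] at h1
  -- Only the term `s = 0` of Shanks' sum, which is `evenStepProd 2 X n`, survives modulo `X ^ (2 *
  -- n + 1)`.
  have h2 : (X : R⟦X⟧) ^ (2 * n + 1) ∣ ∑ s ∈ Finset.range n,
      shanksCoeff X n (s + 1) * X ^ ((s + 1) * (2 * n + 1)) :=
    Finset.dvd_sum fun s _ => (pow_dvd_pow X (Nat.le_mul_of_pos_left _ s.succ_pos)).mul_left _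
  have h3 := h1.add h2
  convert h3 using 1
  simp
  ring

lemma X_pow_dvd_map_sub (φ : R⟦X⟧ →+* R⟦X⟧) (hφ : X ∣ φ X) {m n : ℕ} (h : m ≤ 2 * n + 1) :
    X ^ m ∣ evenStepProd 1 (φ X) n * φ (ramanujanPsi R) - evenStepProd 2 (φ X) n := by
  have h1 := map_dvd φ (X_pow_dvd_evenStepProd_mul_ramanujanPsi_sub (R := R) n)
  rw [map_sub, map_mul, map_evenStepProd, map_evenStepProd, map_pow] at h1
  exact ((pow_dvd_pow X h).trans (pow_dvd_pow_of_dvd hφ _)).trans h1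

lemma isUnit_evenStepProd {q : R⟦X⟧} (hq : X ∣ q) {a : ℕ} (ha : a ≠ 0) (n : ℕ) :
    IsUnit (evenStepProd a q n) := by
  rw [PowerSeries.isUnit_iff_constantCoeff, map_evenStepProd, X_dvd_iff.1 hq]
  simp [evenStepProd, ha]

lemma isUnit_ramanujanPsi : IsUnit (ramanujanPsi R) := by
  rw [PowerSeries.isUnit_iff_constantCoeff, ← coeff_zero_eq_constantCoeff_apply,
    coeff_ramanujanPsi, if_pos ⟨0, by simp⟩]
  exact isUnit_one

end Gauss

/-! ### The product of `ψ` over the cube roots of unity. -/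

section CubeRoots

variable {R S : Type*} [CommRing R] [CommRing S]

/-- The product of `1 - b` over the `b` equal to `q ^ k`, `(w q) ^ k` and `(w ^ 2 q) ^ k`. -/
def cubeFactor (w q : S) (k : ℕ) : S :=
  (1 - q ^ k) * (1 - (w * q) ^ k) * (1 - (w ^ 2 * q) ^ k)

lemma prod_evenStepProd (w q : S) (a n : ℕ) :
    evenStepProd a q n * evenStepProd a (w * q) n * evenStepProd a (w ^ 2 * q) n =
      ∏ k ∈ Finset.range n, cubeFactor w q (2 * k + a) := by
  simp only [evenStepProd, cubeFactor, Finset.prod_mul_distrib]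

lemma cubeFactor_of_dvd {w : S} (hw : w ^ 2 + w + 1 = 0) (q : S) {k : ℕ} (hk : 3 ∣ k) :
    cubeFactor w q k = (1 - q ^ k) ^ 3 := by
  obtain ⟨m, rfl⟩ := hk
  have hw3 : w ^ 3 = 1 := by linear_combination (w - 1) * hw
  rw [cubeFactor, mul_pow, mul_pow, pow_right_comm, pow_mul w, hw3, one_pow]
  ring

/-- Here `w ^ k` is `w` or `w ^ 2`, so the product is `(1 - a)(1 - w a)(1 - w ^ 2 a) = 1 - a ^ 3`
with `a = q ^ k`. -/
lemma cubeFactor_of_not_dvd {w : S} (hw : w ^ 2 + w + 1 = 0) (q : S) {k : ℕ} (hk : ¬ 3 ∣ k) :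
    cubeFactor w q k = 1 - q ^ (3 * k) := by
  have hw3 : w ^ 3 = 1 := by linear_combination (w - 1) * hw
  have hm (m : ℕ) : w ^ (3 * m) = 1 := by rw [pow_mul, hw3, one_pow]
  rw [cubeFactor, mul_pow, mul_pow, pow_right_comm, mul_comm 3 k, pow_mul]
  generalize q ^ k = a
  obtain ⟨m, rfl | rfl⟩ : ∃ m, k = 3 * m + 1 ∨ k = 3 * m + 2 := ⟨k / 3, by omega⟩
  · rw [pow_add, hm]
    linear_combination (-a + a ^ 2 * w - a ^ 3 * (w - 1)) * hw
  · rw [pow_add, hm]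
    linear_combination (-a + a ^ 2 * w - a ^ 3 * (w - 1)) * hw - a * w * hw3 +
      a ^ 2 * (w ^ 3 + w) * hw3 - a ^ 3 * w ^ 3 * hw3

/-- Exponents divisible by 3 produce the cube on the right; the others produce factors of
`evenStepProd 2 (q ^ 3) (3 * n)`, whose missing factors are supplied by `evenStepProd 2 (q ^ 9) n`.
-/
lemma prod_evenStepProd_two {w : S} (hw : w ^ 2 + w + 1 = 0) (q : S) (n : ℕ) :
    evenStepProd 2 q (3 * n) * evenStepProd 2 (w * q) (3 * n) *
        evenStepProd 2 (w ^ 2 * q) (3 * n) * evenStepProd 2 (q ^ 9) n =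
      evenStepProd 2 (q ^ 3) (3 * n) * evenStepProd 2 (q ^ 3) n ^ 3 := by
  rw [prod_evenStepProd]
  induction n with
  | zero => simp
  | succ n ih =>
    rw [show 3 * (n + 1) = 3 * n + 1 + 1 + 1 by ring]
    simp only [evenStepProd_succ, Finset.prod_range_succ]
    rw [cubeFactor_of_not_dvd hw q (k := 2 * (3 * n) + 2) (by omega),
      cubeFactor_of_not_dvd hw q (k := 2 * (3 * n + 1) + 2) (by omega),
      cubeFactor_of_dvd hw q (k := 2 * (3 * n + 1 + 1) + 2) (by omega)]
    rw [← pow_mul q 3, ← pow_mul q 3, ← pow_mul q 3, ← pow_mul q 3, ← pow_mul q 9,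
      show 9 * (2 * n + 2) = 3 * (2 * (3 * n + 1 + 1) + 2) by ring,
      show 3 * (2 * n + 2) = 2 * (3 * n + 1 + 1) + 2 by ring]
    linear_combination (1 - q ^ (3 * (2 * (3 * n) + 2))) *
      (1 - q ^ (3 * (2 * (3 * n + 1) + 2))) * (1 - q ^ (2 * (3 * n + 1 + 1) + 2)) ^ 3 *
      (1 - q ^ (3 * (2 * (3 * n + 1 + 1) + 2))) * ih

lemma prod_evenStepProd_one {w : S} (hw : w ^ 2 + w + 1 = 0) (q : S) (n : ℕ) :
    evenStepProd 1 q (3 * n) * evenStepProd 1 (w * q) (3 * n) *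
        evenStepProd 1 (w ^ 2 * q) (3 * n) * evenStepProd 1 (q ^ 9) n =
      evenStepProd 1 (q ^ 3) (3 * n) * evenStepProd 1 (q ^ 3) n ^ 3 := by
  rw [prod_evenStepProd]
  induction n with
  | zero => simp
  | succ n ih =>
    rw [show 3 * (n + 1) = 3 * n + 1 + 1 + 1 by ring]
    simp only [evenStepProd_succ, Finset.prod_range_succ]
    rw [cubeFactor_of_not_dvd hw q (k := 2 * (3 * n) + 1) (by omega),
      cubeFactor_of_dvd hw q (k := 2 * (3 * n + 1) + 1) (by omega),
      cubeFactor_of_not_dvd hw q (k := 2 * (3 * n + 1 + 1) + 1) (by omega)]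
    rw [← pow_mul q 3, ← pow_mul q 3, ← pow_mul q 3, ← pow_mul q 3, ← pow_mul q 9,
      show 9 * (2 * n + 1) = 3 * (2 * (3 * n + 1) + 1) by ring,
      show 3 * (2 * n + 1) = 2 * (3 * n + 1) + 1 by ring]
    linear_combination (1 - q ^ (3 * (2 * (3 * n) + 1))) *
      (1 - q ^ (2 * (3 * n + 1) + 1)) ^ 3 * (1 - q ^ (3 * (2 * (3 * n + 1 + 1) + 1))) *
      (1 - q ^ (3 * (2 * (3 * n + 1) + 1))) * ih

/-- The product of `ψ` over the cube roots of unity. -/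
theorem ramanujanPsi_mul_rescale {w : R} (hw : w ^ 2 + w + 1 = 0) :
    ramanujanPsi R * rescale w (ramanujanPsi R) * rescale (w ^ 2) (ramanujanPsi R) *
      expandThree (expandThree (ramanujanPsi R)) = expandThree (ramanujanPsi R) ^ 4 := by
  set p := ramanujanPsi R
  have hC : (C w : R⟦X⟧) ^ 2 + C w + 1 = 0 := by
    rw [← map_pow, ← map_add, ← map_one C, ← map_add, hw, map_zero]
  have hX3 : expandThree (X : R⟦X⟧) = X ^ 3 := PowerSeries.expand_X _ _
  have hX9 : (X ^ 3 : R⟦X⟧) ^ 3 = X ^ 9 := (pow_mul _ _ _).symm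
  rw [← sub_eq_zero]
  refine PowerSeries.ext fun m => ?_
  rw [map_zero]
  refine (X_pow_dvd_iff (n := m + 1)).1 ?_ m (Nat.lt_succ_self m)
  set n := m + 1
  -- This unit clears the denominators in Gauss' formula, so the claim modulo `X ^ n` follows from
  -- the two finite product identities.
  have u1 : IsUnit (evenStepProd 1 (X ^ 3 : R⟦X⟧) (3 * n) * evenStepProd 1 (X ^ 3) n ^ 3) :=
    (isUnit_evenStepProd (dvd_pow_self X three_ne_zero) one_ne_zero _).mul
      ((isUnit_evenStepProd (dvd_pow_self X three_ne_zero) one_ne_zero _).pow 3)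
  rw [← u1.dvd_mul_left]
  have d1 := X_pow_dvd_map_sub (RingHom.id R⟦X⟧) dvd_rfl (show n ≤ 2 * (3 * n) + 1 by omega)
  have d2 := X_pow_dvd_map_sub (rescale w) (by rw [rescale_X]; exact dvd_mul_left _ _)
    (show n ≤ 2 * (3 * n) + 1 by omega)
  have d3 := X_pow_dvd_map_sub (rescale (w ^ 2)) (by rw [rescale_X]; exact dvd_mul_left _ _)
    (show n ≤ 2 * (3 * n) + 1 by omega)
  have d4 := X_pow_dvd_map_sub (R := R) (expandThree : R⟦X⟧ →ₐ[R] R⟦X⟧).toRingHom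
    (show X ∣ expandThree X by rw [hX3]; exact dvd_pow_self X three_ne_zero)
    (show n ≤ 2 * (3 * n) + 1 by omega)
  have d5 := X_pow_dvd_map_sub (R := R) (expandThree : R⟦X⟧ →ₐ[R] R⟦X⟧).toRingHom
    (show X ∣ expandThree X by rw [hX3]; exact dvd_pow_self X three_ne_zero)
    (show n ≤ 2 * n + 1 by omega)
  have d6 := X_pow_dvd_map_sub (R := R)
    ((expandThree : R⟦X⟧ →ₐ[R] R⟦X⟧).comp expandThree).toRingHom
    (show X ∣ expandThree (expandThree X) by
      rw [hX3, map_pow, hX3, hX9]; exact dvd_pow_self X (by norm_num))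
    (show n ≤ 2 * n + 1 by omega)
  simp only [AlgHom.toRingHom_eq_coe, RingHom.coe_coe, AlgHom.comp_apply, RingHom.id_apply,
    rescale_X, hX3, map_pow, hX9] at d1 d2 d3 d4 d5 d6
  have i1 := prod_evenStepProd_one hC X n
  have i2 := prod_evenStepProd_two hC X n
  rw [← Ideal.mem_span_singleton, ← Ideal.Quotient.eq_zero_iff_mem] at d1 d2 d3 d4 d5 d6 ⊢
  apply_fun Ideal.Quotient.mk (Ideal.span {(X : R⟦X⟧) ^ n}) at i1 i2
  simp only [map_sub, map_mul, map_pow, sub_eq_zero] at d1 d2 d3 d4 d5 d6 i1 i2 ⊢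
  rw [← d1, ← d2, ← d3, ← d4, ← d5, ← d6] at i2
  set π := Ideal.Quotient.mk (Ideal.span {(X : R⟦X⟧) ^ n})
  linear_combination i2 - π p * π (rescale w p) * π (rescale (w ^ 2) p) *
    π (expandThree (expandThree p)) * i1

end CubeRoots

/-! ### The 3-dissection of `ψ` and the cubic identity. -/

section Dissection

variable {R S : Type*} [CommRing R] [CommRing S]

/-- Triangular numbers congruent to 1 modulo 3 arise exactly from `s = 3 k + 1`, and equal `9 * (k
(k + 1) / 2) + 1`. -/
lemma trisect_one_ramanujanPsi :
    trisect 1 (ramanujanPsi R) = expandThree (ramanujanPsi R) := by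
  ext n
  rw [coeff_trisect, coeff_ramanujanPsi, PowerSeries.coeff_expand, coeff_ramanujanPsi]
  by_cases h : ∃ s, s * (s + 1) = 2 * (3 * n + 1)
  · obtain ⟨s, hs⟩ := h
    obtain ⟨k, rfl | rfl | rfl⟩ : ∃ k, s = 3 * k ∨ s = 3 * k + 1 ∨ s = 3 * k + 2 :=
      ⟨s / 3, by omega⟩
    · exfalso; ring_nf at hs; omega
    · have hn : n = 3 * (n / 3) := by
        have := Nat.two_dvd_mul_add_one k
        ring_nf at hs this; omega
      rw [if_pos ⟨_, hs⟩, if_pos ⟨_, hn⟩, if_pos]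
      refine ⟨k, ?_⟩
      ring_nf at hs ⊢; omega
    · exfalso; ring_nf at hs; omega
  · rw [if_neg h]
    split_ifs with h1 h2
    · obtain ⟨m, rfl⟩ := h1
      obtain ⟨k, hk⟩ := h2
      rw [Nat.mul_div_cancel_left _ (by norm_num)] at hk
      refine absurd ⟨3 * k + 1, ?_⟩ h
      linear_combination 9 * hk
    · rfl
    · rfl

lemma trisect_two_ramanujanPsi : trisect 2 (ramanujanPsi R) = 0 := by
  ext n
  rw [coeff_trisect, coeff_ramanujanPsi, if_neg, map_zero]
  rintro ⟨s, hs⟩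
  obtain ⟨k, rfl | rfl | rfl⟩ : ∃ k, s = 3 * k ∨ s = 3 * k + 1 ∨ s = 3 * k + 2 := ⟨s / 3, by omega⟩
  all_goals ring_nf at hs; omega

/-- The `3`-dissection of `ψ`. -/
lemma ramanujanPsi_eq_dissection :
    ramanujanPsi R = expandThree (trisect 0 (ramanujanPsi R)) +
      X * expandThree (expandThree (ramanujanPsi R)) := by
  conv_lhs => rw [eq_sum_trisect (ramanujanPsi R)]
  simp [Finset.sum_range_succ, trisect_one_ramanujanPsi, trisect_two_ramanujanPsi]

/-- After `X ↦ X ^ 3` the first factor is the norm `(a + X b)(a + w X b)(a + w ^ 2 X b) = a ^ 3 + X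
^ 3 b ^ 3` of the dissection of `ψ`. -/
lemma cubic_identity_of_root {w : R} (hw : w ^ 2 + w + 1 = 0) :
    (trisect 0 (ramanujanPsi R) ^ 3 + X * expandThree (ramanujanPsi R) ^ 3) *
      expandThree (ramanujanPsi R) = ramanujanPsi R ^ 4 := by
  have hw3 : w ^ 3 = 1 := by linear_combination (w - 1) * hw
  have hw6 : (w ^ 2) ^ 3 = 1 := by rw [pow_right_comm, hw3, one_pow]
  have hC : (C w : R⟦X⟧) ^ 2 + C w + 1 = 0 := by
    rw [← map_pow, ← map_add, ← map_one C, ← map_add, hw, map_zero]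
  apply expandThree_injective
  have h := ramanujanPsi_mul_rescale hw
  have hX : expandThree (X : R⟦X⟧) = X ^ 3 := PowerSeries.expand_X _ _
  have h1 : rescale w (ramanujanPsi R) = expandThree (trisect 0 (ramanujanPsi R)) +
      C w * X * expandThree (expandThree (ramanujanPsi R)) := by
    conv_lhs => rw [ramanujanPsi_eq_dissection]
    simp only [map_add, map_mul, rescale_expandThree hw3, rescale_X]
  have h2 : rescale (w ^ 2) (ramanujanPsi R) = expandThree (trisect 0 (ramanujanPsi R)) +
      C w ^ 2 * X * expandThree (expandThree (ramanujanPsi R)) := by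
    conv_lhs => rw [ramanujanPsi_eq_dissection]
    simp only [map_add, map_mul, rescale_expandThree hw6, rescale_X, map_pow]
  rw [h1, h2] at h
  simp only [map_add, map_mul, map_pow, hX]
  rw [← h]
  have h0 := ramanujanPsi_eq_dissection (R := R)
  generalize expandThree (trisect 0 (ramanujanPsi R)) = a at *
  generalize expandThree (expandThree (ramanujanPsi R)) = b at *
  rw [h0]
  linear_combination (-(a ^ 2 * X * b) - a * X ^ 2 * b ^ 2 * C w -
    X ^ 3 * b ^ 3 * (C w - 1)) * b * hC

variable (R) in
/-- The cubic identity for the `3`-dissection of `ψ`. -/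
theorem cubic_identity :
    (trisect 0 (ramanujanPsi R) ^ 3 + X * expandThree (ramanujanPsi R) ^ 3) *
      expandThree (ramanujanPsi R) = ramanujanPsi R ^ 4 := by
  -- All the series are defined over `ℤ`: the identity descends from `ℂ`, where `w` exists, and then
  -- maps to any `R`.
  have hZ : (trisect 0 (ramanujanPsi ℤ) ^ 3 + X * expandThree (ramanujanPsi ℤ) ^ 3) *
      expandThree (ramanujanPsi ℤ) = ramanujanPsi ℤ ^ 4 := by
    have hw := (Complex.isPrimitiveRoot_exp 3 three_ne_zero).geom_sum_eq_zero (by norm_num)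
    rw [Finset.sum_range_succ, Finset.sum_range_succ, Finset.sum_range_one] at hw
    have h := cubic_identity_of_root
      (show Complex.exp (2 * Real.pi * Complex.I / (3 : ℕ)) ^ 2 + _ + 1 = 0 by
        linear_combination hw)
    apply PowerSeries.map_injective (Int.castRingHom ℂ) Int.cast_injective
    simpa only [map_mul, map_add, map_pow, map_trisect, PowerSeries.map_expand, map_ramanujanPsi,
      PowerSeries.map_X] using h
  have := congrArg (PowerSeries.map (Int.castRingHom R)) hZ
  simpa only [map_mul, map_add, map_pow, map_trisect, PowerSeries.map_expand, map_ramanujanPsi,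
    PowerSeries.map_X] using this

end Dissection

/-! ### Iterated trisection of `ψ ^ (-3)` modulo 9. -/

section ModNine

lemma three_dvd_of_map_eq_zero {f : ℤ⟦X⟧} (h : PowerSeries.map (Int.castRingHom (ZMod 3)) f = 0) :
    (3 : ℤ⟦X⟧) ∣ f := by
  have h3 (n : ℕ) : (3 : ℤ) ∣ coeff n f := by
    have := congrArg (coeff n) h
    rw [PowerSeries.coeff_map, map_zero] at this
    exact (ZMod.intCast_zmod_eq_zero_iff_dvd _ 3).1 (by simpa using this)
  choose g hg using h3
  refine ⟨PowerSeries.mk g, ?_⟩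
  ext n
  rw [show (3 : ℤ⟦X⟧) = C 3 from (map_ofNat C 3).symm, coeff_C_mul, coeff_mk, hg]

/-- Modulo 3, cubing is the Frobenius map, which fixes the coefficients in `ZMod 3`. -/
lemma three_dvd_pow_sub_expandThree (f : ℤ⟦X⟧) : (3 : ℤ⟦X⟧) ∣ f ^ 3 - expandThree f := by
  apply three_dvd_of_map_eq_zero
  have : Fact (Nat.Prime 3) := ⟨Nat.prime_three⟩
  set g := PowerSeries.map (Int.castRingHom (ZMod 3)) f
  have h : MvPowerSeries.map (frobenius (ZMod 3) 3) (MvPowerSeries.expand 3 three_ne_zero g) =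
    g ^ 3 := MvPowerSeries.map_frobenius_expand 3 three_ne_zero
  rw [ZMod.frobenius_zmod, MvPowerSeries.map_id] at h
  rw [map_sub, map_pow, PowerSeries.map_expand, sub_eq_zero]
  exact h.symm

lemma nine_dvd_cube_sub_cube {S : Type*} [CommRing S] {a b : S} (h : (3 : S) ∣ a - b) :
    (9 : S) ∣ a ^ 3 - b ^ 3 := by
  obtain ⟨c, hc⟩ := h
  refine ⟨c * (b ^ 2 + 3 * b * c + 3 * c ^ 2), ?_⟩
  rw [sub_eq_iff_eq_add.1 hc]
  ring

lemma nine_eq_zero : (9 : (ZMod 9)⟦X⟧) = 0 := by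
  rw [← map_ofNat C 9, show (OfNat.ofNat 9 : ZMod 9) = 0 from rfl, map_zero]

lemma ramanujanPsi_pow_nine :
    ramanujanPsi (ZMod 9) ^ 9 = expandThree (ramanujanPsi (ZMod 9)) ^ 3 := by
  obtain ⟨c, hc⟩ := nine_dvd_cube_sub_cube (three_dvd_pow_sub_expandThree (ramanujanPsi ℤ))
  have := congrArg (PowerSeries.map (Int.castRingHom (ZMod 9))) hc
  simp only [map_sub, map_pow, PowerSeries.map_expand, map_ramanujanPsi, map_mul, map_ofNat,
    nine_eq_zero, zero_mul, sub_eq_zero, ← pow_mul] at this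
  exact this

lemma trisect_sum_three {R : Type*} [CommRing R] {r : ℕ} (hr : r < 3) (f g h : R⟦X⟧) :
    trisect r (expandThree f + X * expandThree g + X ^ 2 * expandThree h) =
      if r = 0 then f else if r = 1 then g else h := by
  have h0 := trisect_X_pow_mul_expandThree hr (i := 0) (by norm_num) f
  have h1 := trisect_X_pow_mul_expandThree hr (i := 1) (by norm_num) g
  have h2 := trisect_X_pow_mul_expandThree hr (i := 2) (by norm_num) h
  rw [pow_zero, one_mul] at h0
  rw [pow_one] at h1
  rw [map_add, map_add, h0, h1, h2]
  interval_cases r <;> simp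

variable {D : (ZMod 9)⟦X⟧}

local notation "ψ" => ramanujanPsi (ZMod 9)

lemma trisect_zero_inv_cube (hD : D * ψ = 1) :
    trisect 0 (D ^ 3) * expandThree ψ ^ 2 = ψ ^ 5 := by
  have hX : expandThree (X : (ZMod 9)⟦X⟧) = X ^ 3 := PowerSeries.expand_X _ _
  have h6 : expandThree (ψ ^ 3) * D ^ 3 = ψ ^ 6 := by
    rw [map_pow, ← ramanujanPsi_pow_nine]
    calc ψ ^ 9 * D ^ 3 = ψ ^ 6 * (D * ψ) ^ 3 := by ring
      _ = ψ ^ 6 := by rw [hD]; ring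
  have hU : ψ ^ 3 * trisect 0 (D ^ 3) =
      (trisect 0 ψ ^ 3 + X * expandThree ψ ^ 3) ^ 2 := by
    rw [← trisect_expandThree_mul (by norm_num), h6]
    set a := trisect 0 ψ with ha
    set b := expandThree ψ with hb
    have : ψ ^ 6 = expandThree (a ^ 6 + 20 * X * a ^ 3 * b ^ 3 + X ^ 2 * b ^ 6) +
        X * expandThree (6 * a ^ 5 * b + 15 * X * a ^ 2 * b ^ 4) +
        X ^ 2 * expandThree (15 * a ^ 4 * b ^ 2 + 6 * X * a * b ^ 5) := by
      rw [ramanujanPsi_eq_dissection, ← ha, ← hb]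
      simp only [map_add, map_mul, map_pow, hX, map_ofNat]
      ring
    rw [this, trisect_sum_three (by norm_num), if_pos rfl]
    -- The binomial coefficient 20 becomes 2 modulo 9, which completes the square.
    linear_combination 2 * X * a ^ 3 * b ^ 3 * nine_eq_zero
  have hu : IsUnit (ψ ^ 3) := isUnit_ramanujanPsi.pow 3
  rw [← hu.mul_right_inj, ← mul_assoc, hU, ← mul_pow, cubic_identity]
  ring

lemma trisect_two_of_mul_sq {F : (ZMod 9)⟦X⟧} (hF : F * expandThree ψ ^ 2 = ψ ^ 5) :
    trisect 2 F = expandThree ψ * ψ ^ 2 := by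
  have hX : expandThree (X : (ZMod 9)⟦X⟧) = X ^ 3 := PowerSeries.expand_X _ _
  have hU : ψ ^ 2 * trisect 2 F =
      expandThree ψ ^ 2 * (trisect 0 ψ ^ 3 + X * expandThree ψ ^ 3) := by
    rw [← trisect_expandThree_mul (by norm_num), map_pow, mul_comm, hF]
    set a := trisect 0 ψ with ha
    set b := expandThree ψ with hb
    have : ψ ^ 5 = expandThree (a ^ 5 + 10 * X * a ^ 2 * b ^ 3) +
        X * expandThree (5 * a ^ 4 * b + 5 * X * a * b ^ 4) +
        X ^ 2 * expandThree (10 * a ^ 3 * b ^ 2 + X * b ^ 5) := by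
      rw [ramanujanPsi_eq_dissection, ← ha, ← hb]
      simp only [map_add, map_mul, map_pow, hX, map_ofNat]
      ring
    rw [this, trisect_sum_three (by norm_num), if_neg (by norm_num), if_neg (by norm_num)]
    -- Here 10 becomes 1 modulo 9, and the factor of `cubic_identity` appears.
    linear_combination a ^ 3 * b ^ 2 * nine_eq_zero
  have hu : IsUnit (ψ ^ 2) := isUnit_ramanujanPsi.pow 2
  have hB : IsUnit (expandThree ψ) := isUnit_ramanujanPsi.map _
  rw [← hu.mul_right_inj, ← hB.mul_left_inj, hU, mul_assoc, cubic_identity]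
  ring

lemma trisect_two_expandThree_mul_sq :
    trisect 2 (expandThree ψ * ψ ^ 2) = ψ * expandThree ψ ^ 2 := by
  rw [trisect_expandThree_mul (by norm_num)]
  set a := trisect 0 ψ with ha
  set b := expandThree ψ with hb
  have : ψ ^ 2 = expandThree (a ^ 2) + X * expandThree (2 * a * b) +
      X ^ 2 * expandThree (b ^ 2) := by
    rw [ramanujanPsi_eq_dissection, ← ha, ← hb]
    simp only [map_mul, map_pow, map_ofNat]
    ring
  rw [this, trisect_sum_three (by norm_num), if_neg (by norm_num), if_neg (by norm_num)]

lemma coeff_inv_cube (hD : D * ψ = 1) (k : ℕ) :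
    coeff (9 * k + 6) (D ^ 3) = coeff k (expandThree ψ * ψ ^ 2) := by
  rw [← trisect_two_of_mul_sq (trisect_zero_inv_cube hD), coeff_trisect, coeff_trisect]
  congr 2
  ring

lemma coeff_inv_cube' (hD : D * ψ = 1) (j : ℕ) :
    coeff (27 * j + 24) (D ^ 3) = coeff j (expandThree (ψ ^ 2) * ψ) := by
  rw [show 27 * j + 24 = 9 * (3 * j + 2) + 6 by ring, coeff_inv_cube hD, ← coeff_trisect,
    trisect_two_expandThree_mul_sq, map_pow, mul_comm]

/-- Vanishing modulo `9` of the coefficients of `ψ ^ (-3)` in a residue class modulo `81`. -/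
theorem coeff_inv_cube_eq_zero (hD : D * ψ = 1) (m : ℕ) : coeff (81 * m + 78) (D ^ 3) = 0 := by
  rw [show 81 * m + 78 = 27 * (3 * m + 2) + 24 by ring, coeff_inv_cube' hD, ← coeff_trisect,
    trisect_expandThree_mul (by norm_num), trisect_two_ramanujanPsi, mul_zero, map_zero]

/-- Self-similarity modulo `9` of the coefficients of `ψ ^ (-3)`. -/
theorem coeff_inv_cube_self_similar (hD : D * ψ = 1) (k : ℕ) :
    coeff (81 * k + 51) (D ^ 3) = coeff (9 * k + 6) (D ^ 3) := by
  rw [show 81 * k + 51 = 27 * (3 * k + 1) + 24 by ring, coeff_inv_cube' hD, ← coeff_trisect,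
    trisect_expandThree_mul (by norm_num), trisect_one_ramanujanPsi, coeff_inv_cube hD, mul_comm]

end ModNine

/-! ### The generating function of `podNeg` and the progressions. -/

section Pod

variable {R : Type*} [CommRing R]

/-- The weight of `c` copies of the part `i`: it vanishes for repeated odd parts. -/
def podWeight (R : Type*) [CommRing R] (i c : ℕ) : R :=
  if Odd i then (if c = 1 then -1 else 0) else 1

/-- For an admissible partition, `c` copies of `i` have weight `(-1) ^ (c * i)`, and these exponents
add up to `n`. -/
lemma sum_podWeight (n : ℕ) :
    ∑ p : n.Partition, p.parts.toFinsupp.prod (podWeight R) =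
      (-1) ^ n * ((podPartitions n).card : R) := by
  have h (p : n.Partition) : p.parts.toFinsupp.prod (podWeight R) =
      if p ∈ podPartitions n then (-1) ^ n else 0 := by
    rw [Finsupp.prod, Multiset.toFinsupp_support]
    simp only [Multiset.toFinsupp_apply]
    split_ifs with hp
    · rw [podPartitions, Finset.mem_filter_univ] at hp
      have hn : ∑ i ∈ p.parts.toFinset, p.parts.count i * i = n := by
        have := Finset.sum_multiset_count p.parts
        simpa [p.parts_sum] using this.symm
      conv_rhs => rw [← hn, ← Finset.prod_pow_eq_pow_sum]
      refine Finset.prod_congr rfl fun i hi => ?_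
      rw [Multiset.mem_toFinset] at hi
      have h1 := Multiset.one_le_count_iff_mem.2 hi
      rw [podWeight]
      split_ifs with ho hc
      · rw [hc, one_mul, ho.neg_one_pow]
      · exact absurd (le_antisymm (hp i hi ho) h1) hc
      · rw [((Nat.not_odd_iff_even.1 ho).mul_left _).neg_one_pow]
    · rw [podPartitions, Finset.mem_filter_univ] at hp
      push Not at hp
      obtain ⟨i, hi, ho, hc⟩ := hp
      refine Finset.prod_eq_zero (Multiset.mem_toFinset.2 hi) ?_
      rw [podWeight, if_pos ho, if_neg hc.ne']
  simp only [h, Finset.sum_ite_mem, Finset.univ_inter, Finset.sum_const, nsmul_eq_mul]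
  ring

/-- The generating function `∑ (-1) ^ n pod(n) X ^ n`. -/
noncomputable def podSeries (R : Type*) [CommRing R] : R⟦X⟧ :=
  Nat.Partition.genFun (podWeight R)

lemma coeff_podSeries (n : ℕ) :
    coeff n (podSeries R) = (-1) ^ n * ((podPartitions n).card : R) := by
  rw [podSeries, Nat.Partition.coeff_genFun, sum_podWeight]

open scoped PowerSeries.WithPiTopology in
theorem podSeries_mul_ramanujanPsi : podSeries R * ramanujanPsi R = 1 := by
  let _ : TopologicalSpace R := ⊥
  have : DiscreteTopology R := ⟨rfl⟩
  have hodd (k : ℕ) : (1 + ∑' j, podWeight R (2 * k + 1) (j + 1) •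
      (X : R⟦X⟧) ^ ((2 * k + 1) * (j + 1))) = 1 - X ^ (2 * k + 1) := by
    rw [tsum_eq_single 0]
    · simp [podWeight, sub_eq_add_neg]
    · intro j hj
      simp [podWeight, hj]
  have heven (k : ℕ) : (1 + ∑' j, podWeight R (2 * k + 1 + 1) (j + 1) •
      (X : R⟦X⟧) ^ ((2 * k + 1 + 1) * (j + 1))) * (1 - X ^ (2 * k + 2)) = 1 := by
    have h0 : constantCoeff ((X : R⟦X⟧) ^ (2 * k + 2)) = 0 := by simp
    have ho : ¬ Odd (2 * k + 1 + 1) := by rw [Nat.not_odd_iff_even]; exact ⟨k + 1, by ring⟩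
    have hs := PowerSeries.WithPiTopology.summable_pow_of_constantCoeff_eq_zero h0
    have := PowerSeries.WithPiTopology.tsum_pow_mul_one_sub_of_constantCoeff_eq_zero h0
    rw [hs.tsum_eq_zero_add, pow_zero] at this
    rw [← this]
    congr 3
    ext1 j
    rw [podWeight, if_neg ho, one_smul, ← pow_mul]
  have hprod := Nat.Partition.hasProd_genFun (podWeight R)
  have htend := (hprod.tendsto_prod_nat.comp
    (Filter.tendsto_id.const_mul_atTop' (show 0 < 2 by norm_num))).mul_const (ramanujanPsi R)
  -- The partial products over parts up to `2 n`, times `ψ`, also tend to 1: by the truncated Gauss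
  -- identity, their coefficient at `d` is final once `n ≥ d`.
  refine tendsto_nhds_unique htend ?_
  rw [PowerSeries.WithPiTopology.tendsto_iff_coeff_tendsto]
  intro d
  refine tendsto_atTop_of_eventually_const (i₀ := d) fun n hn => ?_
  have hfin (m : ℕ) : (∏ i ∈ Finset.range (2 * m), (1 + ∑' j, podWeight R (i + 1) (j + 1) •
      (X : R⟦X⟧) ^ ((i + 1) * (j + 1)))) * evenStepProd 2 X m = evenStepProd 1 X m := by
    induction m with
    | zero => simp
    | succ m ih =>
      rw [show 2 * (m + 1) = 2 * m + 1 + 1 by ring, Finset.prod_range_succ,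
        Finset.prod_range_succ, evenStepProd_succ, evenStepProd_succ, hodd, ← ih]
      linear_combination (∏ i ∈ Finset.range (2 * m), (1 + ∑' j, podWeight R (i + 1) (j + 1) •
        (X : R⟦X⟧) ^ ((i + 1) * (j + 1)))) * (1 - X ^ (2 * m + 1)) * evenStepProd 2 X m * heven m
  rw [← sub_eq_zero, ← map_sub]
  refine X_pow_dvd_iff.1 ?_ d (show d < 2 * n + 1 by omega)
  have hu : IsUnit (evenStepProd 2 (X : R⟦X⟧) n) := isUnit_evenStepProd dvd_rfl two_ne_zero n
  rw [← hu.dvd_mul_left]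
  convert X_pow_dvd_evenStepProd_mul_ramanujanPsi_sub (R := R) n using 1
  rw [← hfin n]
  simp only [Function.comp, id]
  ring

lemma coeff_podSeries_pow (k n : ℕ) :
    coeff n (podSeries R ^ k) = (-1) ^ n * (podNeg k n : R) := by
  classical
  have h := coeff_prod (fun _ : Fin k => podSeries R) n Finset.univ
  rw [Finset.prod_const, Finset.card_univ, Fintype.card_fin] at h
  rw [h, podNeg, podTuples, Finset.card_sigma, Nat.cast_sum, Finset.mul_sum]
  refine Finset.sum_equiv Finsupp.equivFunOnFinite
    (fun l => by simp [Finset.Nat.mem_antidiagonalTuple]) fun l hl => ?_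
  rw [Finset.mem_finsuppAntidiag] at hl
  simp only [coeff_podSeries, Finset.prod_mul_distrib, Finset.prod_pow_eq_pow_sum, hl.1]
  rw [Fintype.card_piFinset, Nat.cast_prod]
  rfl

lemma nine_dvd_podNeg_iff (n : ℕ) :
    9 ∣ podNeg 3 n ↔ coeff n (podSeries (ZMod 9) ^ 3) = 0 := by
  rw [coeff_podSeries_pow, ← ZMod.natCast_eq_zero_iff]
  rcases neg_one_pow_eq_or (ZMod 9) n with h | h <;> simp [h]

/-- The residue modulo `81 * 9 ^ j` of the `j`-th progression on which `9` divides `podNeg 3`. -/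
def podResidue : ℕ → ℕ
  | 0 => 78
  | j + 1 => 9 * podResidue j - 3

lemma eight_mul_podResidue (j : ℕ) : 8 * podResidue j = 23 * 3 ^ (2 * j + 3) + 3 := by
  induction j with
  | zero => rfl
  | succ j ih =>
    rw [podResidue, show 2 * (j + 1) + 3 = 2 * j + 3 + 2 by ring, pow_add]
    omega

lemma podResidue_lt (j : ℕ) : podResidue j < 81 * 9 ^ j := by
  have := eight_mul_podResidue j
  have h9 : 9 ^ j = 3 ^ (2 * j) := by rw [pow_mul]; rfl
  have : 0 < 3 ^ (2 * j) := by positivity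
  rw [pow_add] at *
  omega

theorem nine_dvd_podNeg_progression (j m : ℕ) :
    9 ∣ podNeg 3 (81 * 9 ^ j * m + podResidue j) := by
  rw [nine_dvd_podNeg_iff]
  induction j with
  | zero => simpa [podResidue] using coeff_inv_cube_eq_zero podSeries_mul_ramanujanPsi m
  | succ j ih =>
    obtain ⟨k, hk⟩ : ∃ k, 81 * 9 ^ j * m + podResidue j = 9 * k + 6 := by
      obtain ⟨r, hr⟩ : ∃ r, podResidue j = 9 * r + 6 := by
        have := eight_mul_podResidue j
        rw [pow_add] at this
        exact ⟨podResidue j / 9, by omega⟩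
      exact ⟨9 * 9 ^ j * m + r, by rw [hr]; ring⟩
    rw [hk, ← coeff_inv_cube_self_similar podSeries_mul_ramanujanPsi] at ih
    have h : 81 * 9 ^ (j + 1) * m + podResidue (j + 1) = 81 * k + 51 := by
      rw [podResidue, show 81 * 9 ^ (j + 1) * m = 9 * (81 * 9 ^ j * m) by ring]
      -- This shows `podResidue j > 0`, so the subtraction in `9 * podResidue j - 3` is not
      -- truncated; then `9 * (9 * k + 6) - 3 = 81 * k + 51`.
      have := eight_mul_podResidue j
      omega
    rw [h, ih]

/-- For `x` in the `j`-th progression, `8 x - 3 = 3 ^ (2 j + 3) * (24 m + 23)` has 3-adic valuation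
exactly `2 j + 3`, which determines `j`. -/
lemma podProgression_disjoint {i j m n : ℕ}
    (h : 81 * 9 ^ i * m + podResidue i = 81 * 9 ^ j * n + podResidue j) : i = j := by
  have key (i m : ℕ) : 8 * (81 * 9 ^ i * m + podResidue i) =
      3 ^ (2 * i + 3) * (24 * m + 23) + 3 := by
    rw [mul_add, eight_mul_podResidue, pow_add, pow_mul]
    ring
  have h8 : 3 ^ (2 * i + 3) * (24 * m + 23) = 3 ^ (2 * j + 3) * (24 * n + 23) := by
    have h1 := key i m
    rw [h, key j n] at h1
    omega
  have hv (i m : ℕ) : padicValNat 3 (3 ^ (2 * i + 3) * (24 * m + 23)) = 2 * i + 3 := by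
    have : Fact (Nat.Prime 3) := ⟨Nat.prime_three⟩
    rw [padicValNat.mul (by positivity) (by positivity), padicValNat.prime_pow,
      padicValNat.eq_zero_of_not_dvd (by omega), add_zero]
  have := hv i m
  rw [h8, hv] at this
  omega

end Pod

/-! ### Lower density of a union of disjoint progressions. -/

section Density

open Filter Topology

lemma sub_one_le_card_progression {M : ℕ} (hM : 0 < M) (r N : ℕ) :
    (N : ℝ) / M - 1 ≤ ((Finset.range (N / M)).image fun m => M * m + r).card := by
  rw [Finset.card_image_of_injective _ fun a b h => by simpa [hM.ne'] using h, Finset.card_range]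
  have := Nat.lt_div_mul_add (a := N) hM
  rw [sub_le_iff_le_add, div_le_iff₀ (by exact_mod_cast hM)]
  exact_mod_cast (by nlinarith : N ≤ (N / M + 1) * M)

/-- A set containing pairwise disjoint progressions has lower density at least the sum of their
densities. -/
lemma sum_le_lowerDensity {S : Set ℕ} {M r : ℕ → ℕ} (hM : ∀ j, 0 < M j) (hr : ∀ j, r j < M j)
    (hS : ∀ j m, M j * m + r j ∈ S)
    (hdisj : ∀ i j m n, M i * m + r i = M j * n + r j → i = j) (J : ℕ) :
    ∑ j ∈ Finset.range J, (1 : ℝ) / M j ≤ lowerDensity S := by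
  -- Each of the `J` progressions falls short of its expected count `N / M j` by at most 1, whence
  -- the error `J / N`.
  have hlim : Tendsto (fun N : ℕ => ∑ j ∈ Finset.range J, (1 : ℝ) / M j - J / (N : ℝ)) atTop
      (𝓝 (∑ j ∈ Finset.range J, (1 : ℝ) / M j)) := by
    simpa using (tendsto_const_nhds (x := ∑ j ∈ Finset.range J, (1 : ℝ) / M j)).sub
      (tendsto_const_div_atTop_nhds_zero_nat (J : ℝ))
  rw [← hlim.liminf_eq, lowerDensity]
  refine liminf_le_liminf ?_ hlim.isBoundedUnder_ge ?_
  · filter_upwards [eventually_gt_atTop 0] with N hN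
    have hN' : (0 : ℝ) < N := by exact_mod_cast hN
    rw [le_div_iff₀ hN', sub_mul, div_mul_cancel₀ _ hN'.ne', Finset.sum_mul]
    set T := (Finset.range J).biUnion fun j =>
      (Finset.range (N / M j)).image fun m => M j * m + r j with hT
    have hsub : (T : Set ℕ) ⊆ S ∩ Set.Iio N := by
      intro x hx
      simp only [hT, Finset.coe_biUnion, Set.mem_iUnion, Finset.mem_coe, Finset.mem_image,
        Finset.mem_range] at hx
      obtain ⟨j, -, m, hm, rfl⟩ := hx
      refine ⟨hS j m, ?_⟩
      have h1 : M j * (m + 1) ≤ M j * (N / M j) := Nat.mul_le_mul_left _ hm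
      have h2 := Nat.mul_div_le N (M j)
      have h3 := hr j
      rw [mul_add, mul_one] at h1
      exact Set.mem_Iio.2 (by omega)
    have hcard : T.card ≤ (S ∩ Set.Iio N).ncard := by
      rw [← Set.ncard_coe_finset]
      exact Set.ncard_le_ncard hsub ((Set.finite_Iio N).inter_of_right S)
    refine le_trans ?_ (Nat.cast_le.2 hcard)
    rw [hT, Finset.card_biUnion, Nat.cast_sum]
    · calc ∑ j ∈ Finset.range J, (1 : ℝ) / M j * N - J
          = ∑ j ∈ Finset.range J, ((N : ℝ) / M j - 1) := by
            rw [Finset.sum_sub_distrib, Finset.sum_const, Finset.card_range, nsmul_eq_mul, mul_one]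
            congr 1
            exact Finset.sum_congr rfl fun j _ => by ring
        _ ≤ _ := Finset.sum_le_sum fun j _ => sub_one_le_card_progression (hM j) (r j) N
    · intro i _ j _ hij
      change Disjoint (Finset.image _ _) (Finset.image _ _)
      rw [Finset.disjoint_left]
      intro x hx hy
      rw [Finset.mem_image] at hx hy
      obtain ⟨m, -, rfl⟩ := hx
      obtain ⟨n, -, hn⟩ := hy
      exact hij (hdisj i j m n hn.symm)
  -- A real `liminf` is only meaningful under a bound; the proportions are at most 1.
  · refine IsBoundedUnder.isCoboundedUnder_ge (isBoundedUnder_of ⟨1, fun N => ?_⟩)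
    refine div_le_one_of_le₀ ?_ N.cast_nonneg
    have := Set.ncard_le_ncard (Set.inter_subset_right (s := S) (t := Set.Iio N))
      (Set.finite_Iio N)
    rw [Set.ncard_Iio_nat] at this
    exact_mod_cast this

end Density

theorem corollary2p7 : (1 / 72 : ℝ) ≤ lowerDensity {n : ℕ | 9 ∣ podNeg 3 n} := by
  have h := sum_le_lowerDensity (S := {n : ℕ | 9 ∣ podNeg 3 n}) (M := fun j => 81 * 9 ^ j)
    (r := podResidue) (fun j => by positivity) podResidue_lt nine_dvd_podNeg_progression
    (fun i j m n => podProgression_disjoint)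
  have hs : HasSum (fun j : ℕ => (1 : ℝ) / ((81 * 9 ^ j : ℕ) : ℝ)) (1 / 72) := by
    have := (hasSum_geometric_of_lt_one (r := (1 / 9 : ℝ)) (by norm_num) (by norm_num)).mul_left
      (1 / 81)
    rw [show (1 / 81 : ℝ) * (1 - 1 / 9)⁻¹ = 1 / 72 by norm_num] at this
    refine this.congr_fun fun j => ?_
    push_cast
    rw [one_div_pow, one_div_mul_one_div]
  exact le_of_tendsto' hs.tendsto_sum_nat h
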